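/- Let $d\ge 1$ and $\sigma>0$, and let $\psi:\mathbb{R}^d\to\mathbb{R}$ be bounded, continuous and positive definite (i.e. $\psi(-x)=\psi(x)$ for all $x$, and $\sum_{i,j}c_ic_j\psi(x_i-x_j)\ge 0$ for all finite families of real numbers $c_i$ and points $x_i\in\mathbb{R}^d$). Let $k(x,y)=\psi(x-y)$, let $\mathcal{H}_k$ be its reproducing kernel Hilbert space, and for a Borel probability measure $P$ on $\mathbb{R}^d$ let $\mu_k(P)=\int k(\cdot,x)\,dP(x)\in\mathcal{H}_k$ (Bochner integral) be its kernel mean embedding. Suppose that $k$ is characteristic, i.e. that $P\mapsto\mu_k(P)$ is injective on the Borel probability measures. Let $\Lambda_\psi$ be the finite non-negative Borel measure on $\mathbb{R}^d$ (which exists and is unique) with $$\psi(x)=\frac{1}{(2\pi)^{d/2}}\int_{\mathbb{R}^d}e^{-i\langle x,w\rangle}\,d\Lambda_\psi(w)\quad\text{for all }x\in\mathbb{R}^d.$$ Then there exist constants $\epsilon_{\psi,\sigma^2},c_{\psi,\sigma^2}>0$, depending only on $\psi$ and $\sigma^2$, such that for every $a\in\mathbb{R}^d$ with $\|a\|_2^2\le\epsilon_{\psi,\sigma^2}$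 $$c_{\psi,\sigma^2}\le\min_{e\in S^{d-1}}\frac{2}{(2\pi)^{d/2}}\int_{\mathbb{R}^d}e^{-\sigma^2\|w\|_2^2}\langle e,w\rangle^2\cos(\langle a,w\rangle)\,d\Lambda_\psi(w)<\infty,$$ where $S^{d-1}$ is the unit sphere of $\mathbb{R}^d$ (the integrals converge absolutely and the minimum is attained). Moreover, for all $\mu_0,\mu_1\in\mathbb{R}^d$ with $\|\mu_0-\mu_1\|_2^2\le\epsilon_{\psi,\sigma^2}$, $$\|\theta_0-\theta_1\|_{\mathcal{H}_k}\ge\sqrt{\frac{c_{\psi,\sigma^2}}{2}}\;\|\mu_0-\mu_1\|_2,$$ where $\theta_0=\mu_k(G(\mu_0,\sigma^2I))$ and $\theta_1=\mu_k(G(\mu_1,\sigma^2I))$ are the kernel mean embeddings of the Gaussian measures with means $\mu_0,\mu_1$ and covariance matrix $\sigma^2I$. -/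

import Mathlib

open MeasureTheory ProbabilityTheory
open scoped RealInnerProductSpace BoundedContinuousFunction

noncomputable section

/-- A real function `ψ` on `ℝ^d` is (symmetric and) positive definite: it is even and all its
finite quadratic forms `∑ i, ∑ j, c i * c j * ψ (x i - x j)` are non-negative. -/
def IsPositiveDefinite {d : ℕ} (ψ : EuclideanSpace ℝ (Fin d) → ℝ) : Prop :=
  (∀ x, ψ (-x) = ψ x) ∧
    ∀ (n : ℕ) (x : Fin n → EuclideanSpace ℝ (Fin d)) (c : Fin n → ℝ),
      0 ≤ ∑ i, ∑ j, c i * c j * ψ (x i - x j)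

/-- The translation invariant kernel `k(x, y) = ψ(x - y)`, where a real number `r` is seen as the
operator `v ↦ r * v` on `ℝ`, as in Mathlib's operator-valued kernels. -/
def translationKernel {d : ℕ} (ψ : EuclideanSpace ℝ (Fin d) → ℝ) :
    Matrix (EuclideanSpace ℝ (Fin d)) (EuclideanSpace ℝ (Fin d)) (ℝ →L[ℝ] ℝ) :=
  Matrix.of fun x y => ψ (x - y) • ContinuousLinearMap.id ℝ ℝ

@[simp]
theorem translationKernel_apply {d : ℕ} (ψ : EuclideanSpace ℝ (Fin d) → ℝ)
    (x y : EuclideanSpace ℝ (Fin d)) (r : ℝ) :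
    translationKernel ψ x y r = ψ (x - y) * r := by
  simp [translationKernel]

theorem translationKernel_posSemidef {d : ℕ} {ψ : EuclideanSpace ℝ (Fin d) → ℝ}
    (hψ : IsPositiveDefinite ψ) : (translationKernel ψ).PosSemidef := by
  have key := (RKHS.posSemidef_tfae (K := translationKernel ψ)).out 0 2
  rw [key]
  refine ⟨?_, fun v => ?_⟩
  · ext x y
    rw [Matrix.conjTranspose_apply, ContinuousLinearMap.star_eq_adjoint]
    refine ext_inner_right ℝ fun r => ?_
    rw [ContinuousLinearMap.adjoint_inner_left]
    simp [← hψ.1 (x - y), mul_comm]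
  · let u := v.support.equivFin.symm
    have h := hψ.2 v.support.card (fun i => (u i : EuclideanSpace ℝ (Fin d)))
      (fun i => v (u i))
    have h1 : ∀ f : EuclideanSpace ℝ (Fin d) → ℝ,
        ∑ i, f (u i) = ∑ x ∈ v.support, f x := fun f => by
      rw [Equiv.sum_comp u (fun x => f x), Finset.sum_coe_sort]
    rw [h1 (fun x => ∑ j, v x * v (u j) * ψ (x - u j))] at h
    rw [Finset.sum_congr rfl fun x _ => h1 (fun y => v x * v y * ψ (x - y))] at h
    refine h.trans_eq (Finset.sum_congr rfl fun x _ => Finset.sum_congr rfl fun y _ => ?_)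
    have hxy : ψ (y - x) = ψ (x - y) := by rw [← hψ.1 (x - y), neg_sub]
    change _ = ⟪translationKernel ψ y x (v x), v y⟫
    rw [translationKernel_apply, hxy, real_inner_eq_re_inner]
    simp
    ring

instance {d : ℕ} {ψ : EuclideanSpace ℝ (Fin d) → ℝ} [h : Fact (IsPositiveDefinite ψ)] :
    Fact (translationKernel ψ).PosSemidef :=
  ⟨translationKernel_posSemidef h.out⟩

/-- The reproducing kernel Hilbert space `ℋ_k` of `k(x, y) = ψ(x - y)`. -/
abbrev TranslationRKHS {d : ℕ} (ψ : EuclideanSpace ℝ (Fin d) → ℝ)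
    [Fact (IsPositiveDefinite ψ)] : Type :=
  RKHS.OfKernel (translationKernel ψ)

/-- The kernel mean embedding of `P`: the Bochner integral `∫ k(·, x) dP(x)` in `ℋ_k`. -/
def kernelMean {d : ℕ} (ψ : EuclideanSpace ℝ (Fin d) → ℝ) [Fact (IsPositiveDefinite ψ)]
    (P : Measure (EuclideanSpace ℝ (Fin d))) : TranslationRKHS ψ :=
  ∫ x, RKHS.kerFun (TranslationRKHS ψ) x (1 : ℝ) ∂P

/-- The kernel `k(x, y) = ψ(x - y)` is characteristic: the mean embedding is injective on the Borel
probability measures. -/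
def IsCharacteristic {d : ℕ} (ψ : EuclideanSpace ℝ (Fin d) → ℝ)
    [Fact (IsPositiveDefinite ψ)] : Prop :=
  Function.Injective fun P : ProbabilityMeasure (EuclideanSpace ℝ (Fin d)) =>
    kernelMean ψ (P : Measure (EuclideanSpace ℝ (Fin d)))

/-- `Λ` is a finite non-negative Borel measure whose Fourier transform is `ψ`:
`ψ(x) = (2π)^(-d/2) ∫ exp(-i⟨x, w⟩) dΛ(w)` for all `x`. -/
def IsBochnerMeasure {d : ℕ} (ψ : EuclideanSpace ℝ (Fin d) → ℝ)
    (Λ : Measure (EuclideanSpace ℝ (Fin d))) : Prop :=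
  IsFiniteMeasure Λ ∧
    ∀ x, (ψ x : ℂ) = (1 / (2 * Real.pi) ^ ((d : ℝ) / 2) : ℝ) *
      ∫ w, Complex.exp (-Complex.I * (⟪x, w⟫ : ℝ)) ∂Λ

/-- The integrand `exp(-σ²‖w‖²) ⟨e, w⟩² cos⟨a, w⟩`. -/
def spectralIntegrand {d : ℕ} (σ : ℝ) (a e w : EuclideanSpace ℝ (Fin d)) : ℝ :=
  Real.exp (-σ ^ 2 * ‖w‖ ^ 2) * ⟪e, w⟫ ^ 2 * Real.cos ⟪a, w⟫

/-- `2 (2π)^(-d/2) ∫ exp(-σ²‖w‖²) ⟨e, w⟩² cos⟨a, w⟩ dΛ(w)`. -/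
def spectralForm {d : ℕ} (Λ : Measure (EuclideanSpace ℝ (Fin d))) (σ : ℝ)
    (a e : EuclideanSpace ℝ (Fin d)) : ℝ :=
  2 / (2 * Real.pi) ^ ((d : ℝ) / 2) * ∫ w, spectralIntegrand σ a e w ∂Λ

/-- The Gaussian measure `G(μ, σ²I)` on `ℝ^d`. -/
def isotropicGaussian {d : ℕ} (μ : EuclideanSpace ℝ (Fin d)) (σ : ℝ) :
    Measure (EuclideanSpace ℝ (Fin d)) :=
  multivariateGaussian μ (σ ^ 2 • (1 : Matrix (Fin d) (Fin d) ℝ))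

end

/-! With `a = μ₀ - μ₁`, the spectral measure turns the squared distance of the two embeddings into
`(2π)^(-d/2) ∫ exp(-σ²‖w‖²) · 2(1 - cos⟪a, w⟫) dΛ`, and `2(1 - cos s) = s² sinc²(s/2)`. Both bounds
thus concern `∫ exp(-σ²‖w‖²) ⟪e, w⟫² g(⟪a, w⟫) dΛ` for unit `e`, with `g = cos` or `g = sinc²(·/2)`.
This integral is jointly continuous in `(a, e)`. At `a = 0` it is positive: otherwise `Λ` lives on
the hyperplane `e^⊥`, so `ψ e = ψ 0` and the Dirac masses at `e` and `0` have the same embedding.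
Compactness of the sphere gives a uniform bound for small `a`
(`IsBochnerMeasure.exists_pos_le_integral`). Existence of `Λ` is Bochner's theorem
(`IsTranslationFeature.exists_charFun_eq_div`): Gaussian regularisations of `ψ` are characteristic
functions up to scaling, and Prokhorov compactness yields a limit measure. -/

open Filter Topology

/-! ### Feature maps of translation invariant kernels. -/

section FeatureMap

variable {E : Type*} [NormedAddCommGroup E] {H : Type*} [NormedAddCommGroup H]
  [InnerProductSpace ℝ H] {ψ : E → ℝ} {k : E → H}

/-- `k` is a feature map of the translation invariant kernel `ψ (x - y)`. -/
def IsTranslationFeature (ψ : E → ℝ) (k : E → H) : Prop :=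
  ∀ x y, ⟪k x, k y⟫ = ψ (x - y)

theorem IsTranslationFeature.norm_sq (hk : IsTranslationFeature ψ k) (x : E) :
    ‖k x‖ ^ 2 = ψ 0 := by
  rw [← real_inner_self_eq_norm_sq, hk, sub_self]

theorem IsTranslationFeature.even (hk : IsTranslationFeature ψ k) (x : E) : ψ (-x) = ψ x := by
  have h := hk 0 x
  rw [real_inner_comm, hk] at h
  simpa using h.symm

theorem IsTranslationFeature.norm_sub_sq (hk : IsTranslationFeature ψ k) (x y : E) :
    ‖k x - k y‖ ^ 2 = 2 * (ψ 0 - ψ (x - y)) := by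
  rw [norm_sub_sq_real, hk.norm_sq, hk.norm_sq, hk]
  ring

theorem IsTranslationFeature.continuous (hk : IsTranslationFeature ψ k) (hψ : Continuous ψ) :
    Continuous k := by
  rw [continuous_iff_continuousAt]
  intro x
  rw [ContinuousAt, tendsto_iff_norm_sub_tendsto_zero]
  have h : Tendsto (fun y => Real.sqrt (2 * (ψ 0 - ψ (y - x)))) (𝓝 x) (𝓝 0) := by
    have : Continuous fun y => Real.sqrt (2 * (ψ 0 - ψ (y - x))) := by fun_prop
    simpa using this.tendsto x
  refine h.congr fun y => ?_
  rw [← hk.norm_sub_sq, Real.sqrt_sq (norm_nonneg _)]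

theorem IsTranslationFeature.abs_le (hk : IsTranslationFeature ψ k) (x : E) : |ψ x| ≤ ψ 0 := by
  have h := abs_real_inner_le_norm (k x) (k 0)
  have h0 := hk.norm_sq 0
  have hx : ‖k x‖ = ‖k 0‖ := by
    rw [← sq_eq_sq₀ (norm_nonneg _) (norm_nonneg _), hk.norm_sq, hk.norm_sq]
  rw [hk, sub_zero, hx, ← sq, h0] at h
  exact h

variable [MeasurableSpace E] [BorelSpace E] [SecondCountableTopology E]

theorem IsTranslationFeature.integrable_smul (hk : IsTranslationFeature ψ k)
    (hψ : Continuous ψ) {P : Measure E} {g : E → ℝ} (hg : Integrable g P) :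
    Integrable (fun x => g x • k x) P := by
  refine (hg.norm.mul_const (Real.sqrt (ψ 0))).mono'
    (hg.1.smul (hk.continuous hψ).aestronglyMeasurable) (ae_of_all _ fun x => ?_)
  rw [norm_smul, ← hk.norm_sq x, Real.sqrt_sq (norm_nonneg _)]

theorem IsTranslationFeature.inner_integral_smul [CompleteSpace H]
    (hk : IsTranslationFeature ψ k) (hψ : Continuous ψ) {P Q : Measure E} {g h : E → ℝ}
    (hg : Integrable g P) (hh : Integrable h Q) :
    ⟪∫ x, g x • k x ∂P, ∫ y, h y • k y ∂Q⟫ = ∫ x, ∫ y, g x * h y * ψ (x - y) ∂Q ∂P := by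
  rw [real_inner_comm, ← integral_inner (hk.integrable_smul hψ hg)]
  congr with x
  rw [real_inner_comm, ← integral_inner (hk.integrable_smul hψ hh)]
  congr with y
  rw [real_inner_smul_left, real_inner_smul_right, hk]
  ring

theorem IsTranslationFeature.inner_integral [CompleteSpace H]
    (hk : IsTranslationFeature ψ k) (hψ : Continuous ψ) (P Q : Measure E) [IsFiniteMeasure P]
    [IsFiniteMeasure Q] :
    ⟪∫ x, k x ∂P, ∫ y, k y ∂Q⟫ = ∫ x, ∫ y, ψ (x - y) ∂Q ∂P := by
  simpa using hk.inner_integral_smul hψ (integrable_const (1 : ℝ) (μ := P))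
    (integrable_const (1 : ℝ) (μ := Q))

end FeatureMap

/-! ### Consequences of being characteristic. -/

section RKHS

variable {d : ℕ} {ψ : EuclideanSpace ℝ (Fin d) → ℝ} [Fact (IsPositiveDefinite ψ)]

variable (ψ) in
theorem isTranslationFeature_kerFun :
    IsTranslationFeature ψ fun x => RKHS.kerFun (TranslationRKHS ψ) x (1 : ℝ) := by
  intro x y
  rw [← RKHS.kernel_inner, RKHS.OfKernel.kernel_ofKernel, translationKernel_apply,
    (by rw [← (Fact.out : IsPositiveDefinite ψ).1, neg_sub] : ψ (y - x) = ψ (x - y))]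
  simp

/-- Since `‖k x - k 0‖² = 2(ψ 0 - ψ x)`, equality would give the Dirac masses at `x` and `0` the
same embedding. -/
theorem IsCharacteristic.apply_lt_apply_zero (hchar : IsCharacteristic ψ) (hψ : Continuous ψ)
    {x : EuclideanSpace ℝ (Fin d)} (hx : x ≠ 0) : ψ x < ψ 0 := by
  have hk := isTranslationFeature_kerFun ψ
  have hne : RKHS.kerFun (TranslationRKHS ψ) x (1 : ℝ) ≠
      RKHS.kerFun (TranslationRKHS ψ) 0 (1 : ℝ) := by
    intro h
    have := @hchar ⟨Measure.dirac x, inferInstance⟩ ⟨Measure.dirac 0, inferInstance⟩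
      (by
        have hm := (hk.continuous hψ).stronglyMeasurable
        simp only [kernelMean, ProbabilityMeasure.coe_mk]
        rw [integral_dirac' _ _ hm, integral_dirac' _ _ hm, h])
    have h2 : Measure.dirac x = Measure.dirac (0 : EuclideanSpace ℝ (Fin d)) :=
      congrArg Subtype.val this
    exact hx (dirac_eq_dirac_iff.mp h2)
  have h := hk.norm_sub_sq x 0
  have h3 := pow_pos (norm_pos_iff.mpr (sub_ne_zero.mpr hne)) 2
  rw [sub_zero] at h
  linarith

/-- For any `x ≠ 0`, `‖k x + k 0‖² ≥ 0` gives `-ψ 0 ≤ ψ x`, while `ψ x < ψ 0`. -/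
theorem IsCharacteristic.apply_zero_pos (hchar : IsCharacteristic ψ) (hψ : Continuous ψ)
    (hd : 0 < d) : 0 < ψ 0 := by
  have hk := isTranslationFeature_kerFun ψ
  let x : EuclideanSpace ℝ (Fin d) := EuclideanSpace.single ⟨0, hd⟩ 1
  have hx : x ≠ 0 := by simp [x]
  have h1 := hchar.apply_lt_apply_zero hψ hx
  have h2 := norm_add_sq_real (RKHS.kerFun (TranslationRKHS ψ) x (1 : ℝ))
    (RKHS.kerFun (TranslationRKHS ψ) 0 (1 : ℝ))
  have h3 := hk.norm_sq x
  have h4 := hk.norm_sq 0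
  have h5 := hk x 0
  simp only [sub_zero] at h3 h4 h5
  have := sq_nonneg ‖RKHS.kerFun (TranslationRKHS ψ) x (1 : ℝ) +
    RKHS.kerFun (TranslationRKHS ψ) 0 (1 : ℝ)‖
  linarith

end RKHS

/-! ### Bochner's theorem by Gaussian regularisation. -/

section Bochner

variable {E : Type*} [NormedAddCommGroup E] [InnerProductSpace ℝ E]

variable [FiniteDimensional ℝ E] [MeasurableSpace E] [BorelSpace E]

variable (E) in
theorem integrable_rexp_neg_mul_norm_sq {b : ℝ} (hb : 0 < b) :
    Integrable fun x : E => Real.exp (-b * ‖x‖ ^ 2) := by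
  have h := (GaussianFourier.integrable_cexp_neg_mul_sq_norm_add (V := E)
    (show 0 < (b : ℂ).re from hb) 0 0).norm
  refine h.congr (ae_of_all _ fun x => ?_)
  simp [Complex.norm_exp, ← Complex.ofReal_pow]

variable (E) in
theorem integral_rexp_neg_mul_norm_sq_pos {b : ℝ} (hb : 0 < b) :
    0 < ∫ x : E, Real.exp (-b * ‖x‖ ^ 2) := by
  rw [GaussianFourier.integral_rexp_neg_mul_sq_norm hb]
  positivity

theorem integrable_gaussian_mul {ψ : E → ℝ} (hψ : Continuous ψ) {M : ℝ} (hM : ∀ x, |ψ x| ≤ M)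
    {b : ℝ} (hb : 0 < b) : Integrable fun x : E => ψ x * Real.exp (-b * ‖x‖ ^ 2) := by
  refine ((integrable_rexp_neg_mul_norm_sq E hb).const_mul M).mono'
    (by fun_prop) (ae_of_all _ fun x => ?_)
  rw [norm_mul, Real.norm_eq_abs, Real.norm_eq_abs, Real.abs_exp]
  gcongr
  exact hM x

/-- Completing the square: `2‖x + y‖² + 2‖y‖² = ‖x‖² + 4‖y + x/2‖²`. -/
theorem integral_rexp_neg_two_mul_add_translate {t : ℝ} (x : E) :
    ∫ y : E, Real.exp (-(2 * t) * ‖x + y‖ ^ 2) * Real.exp (-(2 * t) * ‖y‖ ^ 2) =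
      Real.exp (-t * ‖x‖ ^ 2) * ∫ y : E, Real.exp (-(4 * t) * ‖y‖ ^ 2) := by
  rw [← integral_const_mul,
    ← integral_add_right_eq_self (fun y : E => _ * Real.exp (-(4 * t) * ‖y‖ ^ 2))
      ((1 / 2 : ℝ) • x)]
  congr with y
  rw [← Real.exp_add, ← Real.exp_add, norm_add_sq_real, norm_add_sq_real, norm_smul,
    real_inner_smul_right, real_inner_comm, Real.norm_of_nonneg (by norm_num)]
  ring_nf

/-- The Fourier transform of a positive definite function damped by a Gaussian is non-negative. -/
theorem IsTranslationFeature.integral_gaussian_mul_cos_nonneg {H : Type*} [NormedAddCommGroup H]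
    [InnerProductSpace ℝ H] [CompleteSpace H] {ψ : E → ℝ} {k : E → H}
    (hk : IsTranslationFeature ψ k) (hψ : Continuous ψ) {t : ℝ} (ht : 0 < t) (w : E) :
    0 ≤ ∫ x, ψ x * Real.exp (-t * ‖x‖ ^ 2) * Real.cos ⟪x, w⟫ := by
  have hg0 := integrable_rexp_neg_mul_norm_sq E (b := 2 * t) (by positivity)
  have hgc : Integrable fun x : E => Real.exp (-(2 * t) * ‖x‖ ^ 2) * Real.cos ⟪x, w⟫ :=
    hg0.mul_bdd (c := 1) (by fun_prop) (ae_of_all _ fun x => Real.abs_cos_le_one _)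
  have hgs : Integrable fun x : E => Real.exp (-(2 * t) * ‖x‖ ^ 2) * Real.sin ⟪x, w⟫ :=
    hg0.mul_bdd (c := 1) (by fun_prop) (ae_of_all _ fun x => Real.abs_sin_le_one _)
  have hprod {g : E → ℝ} (hg : Integrable g) :
      Integrable (fun z : E × E => g z.1 * g z.2 * ψ (z.1 - z.2)) (volume.prod volume) :=
    (hg.mul_prod hg).mul_bdd (c := ψ 0) (by fun_prop) (ae_of_all _ fun z => hk.abs_le _)
  have hG := (hprod hgc).add (hprod hgs)
  -- Sum of the squared norms of the feature integrals weighted by Gaussian times `cos` and Gaussian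
  -- times `sin`; the subtraction formula merges the two.
  have hsum : 0 ≤ ∫ z : E × E, Real.exp (-(2 * t) * ‖z.1‖ ^ 2) * Real.exp (-(2 * t) * ‖z.2‖ ^ 2) *
      (ψ (z.1 - z.2) * Real.cos ⟪z.1 - z.2, w⟫) ∂(volume.prod volume) := by
    have h1 := hk.inner_integral_smul hψ hgc hgc
    have h2 := hk.inner_integral_smul hψ hgs hgs
    rw [integral_integral (hprod hgc)] at h1
    rw [integral_integral (hprod hgs)] at h2
    have h3 := add_nonneg (real_inner_self_nonneg
      (x := ∫ x, (Real.exp (-(2 * t) * ‖x‖ ^ 2) * Real.cos ⟪x, w⟫) • k x))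
      (real_inner_self_nonneg
      (x := ∫ x, (Real.exp (-(2 * t) * ‖x‖ ^ 2) * Real.sin ⟪x, w⟫) • k x))
    rw [h1, h2, ← integral_add (hprod hgc) (hprod hgs)] at h3
    refine h3.trans_eq (integral_congr_ae (ae_of_all _ fun z => ?_))
    simp only [inner_sub_left, Real.cos_sub]
    ring
  have hGi : Integrable (fun z : E × E =>
      Real.exp (-(2 * t) * ‖z.1‖ ^ 2) * Real.exp (-(2 * t) * ‖z.2‖ ^ 2) *
      (ψ (z.1 - z.2) * Real.cos ⟪z.1 - z.2, w⟫)) (volume.prod volume) := by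
    refine hG.congr (ae_of_all _ fun z => ?_)
    simp only [Pi.add_apply, inner_sub_left, Real.cos_sub]
    ring
  -- The shear `(x, y) ↦ (x + y, y)` turns `ψ (x - y)` into `ψ x`; integrating out `y` leaves the
  -- damping `exp(-t‖x‖²)` times a positive constant.
  have hmp := measurePreserving_add_prod (volume : Measure E) (volume : Measure E)
  have hGi2 := hmp.integrable_comp_of_integrable hGi
  rw [← hmp.map_eq, integral_map hmp.measurable.aemeasurable (by rw [hmp.map_eq]; exact hGi.1)]
    at hsum
  simp only [Function.comp_def, add_sub_cancel_right] at hsum hGi2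
  rw [integral_prod _ hGi2] at hsum
  simp only [integral_mul_const,
    integral_rexp_neg_two_mul_add_translate] at hsum
  have hC := integral_rexp_neg_mul_norm_sq_pos E (b := 4 * t) (by positivity)
  refine nonneg_of_mul_nonneg_left (hsum.trans_eq ?_) hC
  rw [← integral_mul_const]
  congr with x
  ring

theorem integral_mul_cos_eq_integral_mul_cexp {F : E → ℝ} (hF : Integrable F)
    (heven : ∀ x, F (-x) = F x) (w : E) :
    ((∫ x, F x * Real.cos ⟪x, w⟫ : ℝ) : ℂ) = ∫ x, (F x : ℂ) * Complex.exp (-⟪x, w⟫ * Complex.I) := by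
  have hn : ∫ x, (F x : ℂ) * Complex.exp (⟪x, w⟫ * Complex.I) =
      ∫ x, (F x : ℂ) * Complex.exp (-⟪x, w⟫ * Complex.I) := by
    rw [← integral_neg_eq_self]
    simp [heven]
  have hi1 : Integrable fun x => (F x : ℂ) * Complex.exp (-⟪x, w⟫ * Complex.I) :=
    hF.ofReal.mul_bdd (c := 1) (by fun_prop) (ae_of_all _ fun x => by simp [Complex.norm_exp])
  have hi2 : Integrable fun x => (F x : ℂ) * Complex.exp (⟪x, w⟫ * Complex.I) :=
    hF.ofReal.mul_bdd (c := 1) (by fun_prop) (ae_of_all _ fun x => by simp [Complex.norm_exp])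
  have h : ∀ x, ((F x * Real.cos ⟪x, w⟫ : ℝ) : ℂ) =
      ((F x : ℂ) * Complex.exp (⟪x, w⟫ * Complex.I) +
        (F x : ℂ) * Complex.exp (-⟪x, w⟫ * Complex.I)) / 2 := fun x => by
    rw [Complex.ofReal_mul, Complex.ofReal_cos, Complex.cos]
    ring
  rw [← integral_complex_ofReal]
  simp_rw [h]
  rw [integral_div, integral_add hi2 hi1, hn]
  ring

/-- If the Fourier transform of an even integrable function `F` is non-negative, then its product
with a Gaussian is the density of a finite measure, whose characteristic function is the convolution
of `F` with a Gaussian. -/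
theorem exists_isFiniteMeasure_charFun_eq {F : E → ℝ} (hF : Integrable F)
    (heven : ∀ x, F (-x) = F x) (hpos : ∀ w, 0 ≤ ∫ x, F x * Real.cos ⟪x, w⟫) {r : ℝ} (hr : 0 < r) :
    ∃ m : Measure E, IsFiniteMeasure m ∧ ∀ x, charFun m x =
      (Real.pi / r : ℂ) ^ (Module.finrank ℝ E / 2 : ℂ) *
        (∫ z, F z * Real.exp (-(4 * r)⁻¹ * ‖x - z‖ ^ 2) : ℝ) := by
  set f : E → ℝ := fun w => ∫ x, F x * Real.cos ⟪x, w⟫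
  have hfc : Continuous f := by
    refine continuous_of_dominated (bound := fun x => ‖F x‖) (fun w => ?_) (fun w => ?_) hF.norm ?_
    · exact hF.1.mul (by fun_prop)
    · refine ae_of_all _ fun x => ?_
      rw [norm_mul]
      exact mul_le_of_le_one_right (norm_nonneg _) (Real.abs_cos_le_one _)
    · exact ae_of_all _ fun x => by fun_prop
  have hfb : ∀ w, ‖f w‖ ≤ ∫ x, ‖F x‖ := fun w => by
    refine norm_integral_le_of_norm_le hF.norm (ae_of_all _ fun x => ?_)
    rw [norm_mul]
    exact mul_le_of_le_one_right (norm_nonneg _) (Real.abs_cos_le_one _)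
  have hgauss := integrable_rexp_neg_mul_norm_sq E hr
  have hρ : Integrable fun w => f w * Real.exp (-r * ‖w‖ ^ 2) :=
    hgauss.bdd_mul hfc.aestronglyMeasurable (ae_of_all _ hfb)
  have hρm : Measurable fun w => ENNReal.ofReal (f w * Real.exp (-r * ‖w‖ ^ 2)) := by fun_prop
  refine ⟨volume.withDensity fun w => ENNReal.ofReal (f w * Real.exp (-r * ‖w‖ ^ 2)),
    isFiniteMeasure_withDensity_ofReal hρ.2, fun x => ?_⟩
  rw [charFun_apply, integral_withDensity_eq_integral_toReal_smul hρm
    (ae_of_all _ fun w => ENNReal.ofReal_lt_top)]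
  have h1 : ∀ w, (ENNReal.ofReal (f w * Real.exp (-r * ‖w‖ ^ 2))).toReal •
      Complex.exp (⟪w, x⟫ * Complex.I) =
      ∫ z, (F z : ℂ) * Complex.exp (-r * ‖w‖ ^ 2 + Complex.I * ⟪x - z, w⟫) := fun w => by
    rw [ENNReal.toReal_ofReal (mul_nonneg (hpos w) (Real.exp_pos _).le), Complex.real_smul,
      Complex.ofReal_mul, integral_mul_cos_eq_integral_mul_cexp hF heven, mul_assoc,
      ← integral_mul_const]
    congr with z
    rw [mul_assoc, Complex.ofReal_exp, ← Complex.exp_add, ← Complex.exp_add, inner_sub_left,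
      real_inner_comm x w]
    push_cast
    ring_nf
  simp_rw [h1]
  rw [integral_integral_swap]
  · have h2 : ∀ z, ∫ w : E, (F z : ℂ) * Complex.exp (-r * ‖w‖ ^ 2 + Complex.I * ⟪x - z, w⟫) =
        (Real.pi / r : ℂ) ^ (Module.finrank ℝ E / 2 : ℂ) *
          ((F z * Real.exp (-(4 * r)⁻¹ * ‖x - z‖ ^ 2) : ℝ) : ℂ) := fun z => by
      rw [integral_const_mul, GaussianFourier.integral_cexp_neg_mul_sq_norm_add (by simpa using hr),
        Complex.I_sq]
      push_cast
      rw [show (-1 * (‖x - z‖ : ℂ) ^ 2 / (4 * r)) = -(4 * (r : ℂ))⁻¹ * ‖x - z‖ ^ 2 by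
        rw [div_eq_mul_inv]; ring]
      ring
    simp_rw [h2]
    rw [integral_const_mul, integral_complex_ofReal]
  · have hi : Integrable (fun p : E × E => ((Real.exp (-r * ‖p.1‖ ^ 2) : ℝ) : ℂ) * (F p.2 : ℂ))
        (volume.prod volume) := hgauss.ofReal.mul_prod hF.ofReal
    refine (hi.mul_bdd (c := 1) (g := fun p : E × E => Complex.exp (Complex.I * ⟪x - p.2, p.1⟫))
      (by fun_prop) (ae_of_all _ fun p => by simp [Complex.norm_exp])).congr
      (ae_of_all _ fun p => ?_)
    simp only [Function.uncurry]
    rw [Complex.exp_add]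
    push_cast
    ring

/-- A Gaussian average of a Gaussian damping of `ψ` around `x`, at scale `δ`. -/
noncomputable def gaussianSmoothing (ψ : E → ℝ) (δ : ℝ) (x : E) : ℝ :=
  ∫ u, ψ (x + δ • u) * Real.exp (-δ ^ 2 * ‖x + δ • u‖ ^ 2) * Real.exp (-1 * ‖u‖ ^ 2)

theorem tendsto_gaussianSmoothing {ψ : E → ℝ} (hψ : Continuous ψ) {M : ℝ} (hM : ∀ x, |ψ x| ≤ M)
    (x : E) : Tendsto (fun δ => gaussianSmoothing ψ δ x) (𝓝 0)
      (𝓝 (ψ x * ∫ u : E, Real.exp (-1 * ‖u‖ ^ 2))) := by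
  have h : Continuous fun δ => gaussianSmoothing ψ δ x := by
    refine continuous_of_dominated (bound := fun u => M * Real.exp (-1 * ‖u‖ ^ 2))
      (fun δ => by fun_prop) (fun δ => ae_of_all _ fun u => ?_)
      ((integrable_rexp_neg_mul_norm_sq E one_pos).const_mul M) (ae_of_all _ fun u => by fun_prop)
    rw [norm_mul, norm_mul, Real.norm_eq_abs, Real.norm_eq_abs, Real.norm_eq_abs, Real.abs_exp,
      Real.abs_exp]
    gcongr
    refine (mul_le_of_le_one_right (abs_nonneg _) ?_).trans (hM _)
    rw [Real.exp_le_one_iff, neg_mul, neg_nonpos]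
    positivity
  have h0 := h.tendsto 0
  simpa [gaussianSmoothing, integral_const_mul] using h0

/-- Substitution `z = x + δu`. The value `r = δ²/4` makes the convolving Gaussian have scale exactly
`δ`. -/
theorem integral_mul_gaussian_eq_gaussianSmoothing (ψ : E → ℝ) {δ : ℝ} (hδ : 0 < δ) (x : E) :
    ∫ z, ψ z * Real.exp (-δ ^ 2 * ‖z‖ ^ 2) * Real.exp (-(4 * (δ ^ 2 / 4))⁻¹ * ‖x - z‖ ^ 2) =
      δ ^ Module.finrank ℝ E * gaussianSmoothing ψ δ x := by
  set h : E → ℝ := fun z => ψ z * Real.exp (-δ ^ 2 * ‖z‖ ^ 2) *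
    Real.exp (-(4 * (δ ^ 2 / 4))⁻¹ * ‖x - z‖ ^ 2) with hh
  have h1 : gaussianSmoothing ψ δ x = ∫ u, h (x + δ • u) := by
    rw [gaussianSmoothing]
    congr with u
    rw [hh]
    simp only [sub_add_cancel_left, norm_neg, norm_smul, Real.norm_of_nonneg hδ.le]
    congr 2
    field_simp
  rw [h1, Measure.integral_comp_smul volume (fun z => h (x + z)), integral_add_left_eq_self,
    abs_of_pos (by positivity), smul_eq_mul, mul_inv_cancel_left₀ (by positivity)]

theorem IsTranslationFeature.exists_charFun_eq_gaussianSmoothing_div {H : Type*}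
    [NormedAddCommGroup H] [InnerProductSpace ℝ H] [CompleteSpace H] {ψ : E → ℝ} {k : E → H}
    (hk : IsTranslationFeature ψ k) (hψ : Continuous ψ) {δ : ℝ} (hδ : 0 < δ)
    (h0 : gaussianSmoothing ψ δ 0 ≠ 0) :
    ∃ ν : Measure E, IsProbabilityMeasure ν ∧
      ∀ x, charFun ν x = ((gaussianSmoothing ψ δ x / gaussianSmoothing ψ δ 0 : ℝ) : ℂ) := by
  obtain ⟨m, hm, hmc⟩ := exists_isFiniteMeasure_charFun_eq
    (integrable_gaussian_mul hψ hk.abs_le (pow_pos hδ 2)) (fun x => by rw [hk.even, norm_neg])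
    (hk.integral_gaussian_mul_cos_nonneg hψ (pow_pos hδ 2)) (r := δ ^ 2 / 4) (by positivity)
  simp_rw [integral_mul_gaussian_eq_gaussianSmoothing ψ hδ] at hmc
  have hA : ((Real.pi : ℂ) / ((δ ^ 2 / 4 : ℝ) : ℂ)) ^ (Module.finrank ℝ E / 2 : ℂ) ≠ 0 := by
    rw [Complex.cpow_ne_zero_iff]
    left
    have : Real.pi / (δ ^ 2 / 4) ≠ 0 := by positivity
    exact_mod_cast this
  set A := ((Real.pi : ℂ) / ((δ ^ 2 / 4 : ℝ) : ℂ)) ^ (Module.finrank ℝ E / 2 : ℂ)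
  have hmass : charFun m 0 = m.real Set.univ := by simp
  have hδn : (δ : ℂ) ^ Module.finrank ℝ E ≠ 0 := by
    exact pow_ne_zero _ (by exact_mod_cast hδ.ne')
  have h0' : ((gaussianSmoothing ψ δ 0 : ℝ) : ℂ) ≠ 0 := by exact_mod_cast h0
  have hne : (m.real Set.univ : ℂ) ≠ 0 := by
    rw [← hmass, hmc]
    push_cast
    exact mul_ne_zero hA (mul_ne_zero hδn h0')
  have : NeZero m := ⟨by rintro rfl; simp at hne⟩
  refine ⟨(m Set.univ)⁻¹ • m, inferInstance, fun x => ?_⟩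
  rw [charFun_apply, integral_smul_measure, ← charFun_apply, ENNReal.toReal_inv, hmc,
    Complex.real_smul, Complex.ofReal_inv, ← measureReal_def, ← hmass, hmc]
  push_cast
  field_simp

/-- **Bochner's theorem**, existence part, for real functions. -/
theorem IsTranslationFeature.exists_charFun_eq_div {H : Type*}
    [NormedAddCommGroup H] [InnerProductSpace ℝ H] [CompleteSpace H] {ψ : E → ℝ} {k : E → H}
    (hk : IsTranslationFeature ψ k) (hψ : Continuous ψ) (h0 : 0 < ψ 0) :
    ∃ ν : Measure E, IsProbabilityMeasure ν ∧ ∀ x, charFun ν x = ((ψ x / ψ 0 : ℝ) : ℂ) := by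
  have hK := integral_rexp_neg_mul_norm_sq_pos E one_pos
  set K := ∫ u : E, Real.exp (-1 * ‖u‖ ^ 2)
  have hu := tendsto_one_div_add_atTop_nhds_zero_nat (𝕜 := ℝ)
  have hlim : ∀ x, Tendsto (fun n : ℕ => gaussianSmoothing ψ (1 / ((n : ℝ) + 1)) x) atTop
      (𝓝 (ψ x * K)) := fun x => (tendsto_gaussianSmoothing hψ hk.abs_le x).comp hu
  have hne : ∀ᶠ n : ℕ in atTop, gaussianSmoothing ψ (1 / ((n : ℝ) + 1)) 0 ≠ 0 :=
    (hlim 0).eventually_ne (mul_pos h0 hK).ne'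
  -- The Dirac mass is a filler for those `n` where normalisation is impossible; by `hne` these do
  -- not affect the limit.
  have hex : ∀ n : ℕ, ∃ ν : ProbabilityMeasure E,
      gaussianSmoothing ψ (1 / ((n : ℝ) + 1)) 0 ≠ 0 → ∀ x, charFun (ν : Measure E) x =
        ((gaussianSmoothing ψ (1 / ((n : ℝ) + 1)) x /
          gaussianSmoothing ψ (1 / ((n : ℝ) + 1)) 0 : ℝ) : ℂ) := fun n => by
    by_cases hn : gaussianSmoothing ψ (1 / ((n : ℝ) + 1)) 0 = 0
    · exact ⟨⟨Measure.dirac 0, inferInstance⟩, fun h => (h hn).elim⟩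
    · obtain ⟨ν, hν, h⟩ := hk.exists_charFun_eq_gaussianSmoothing_div hψ
        (Nat.one_div_pos_of_nat (n := n)) hn
      exact ⟨⟨ν, hν⟩, fun _ => h⟩
  choose ν hν using hex
  have hchar : ∀ x, Tendsto (fun n => charFun (ν n : Measure E) x) atTop
      (𝓝 ((ψ x / ψ 0 : ℝ) : ℂ)) := fun x => by
    have h1 := ((hlim x).div (hlim 0) (mul_pos h0 hK).ne')
    rw [mul_div_mul_right _ _ hK.ne'] at h1
    refine (Complex.continuous_ofReal.continuousAt.tendsto.comp h1).congr' ?_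
    filter_upwards [hne] with n hn
    exact (hν n hn x).symm
  -- Tightness comes from continuity of the limit function; Prokhorov then supplies a convergent
  -- subsequence.
  have htight : IsTightMeasureSet (Set.range fun n => (ν n : Measure E)) :=
    isTightMeasureSet_of_tendsto_charFun (f := fun x => ((ψ x / ψ 0 : ℝ) : ℂ))
      (by fun_prop) hchar
  have hcomp : IsCompact (closure (Set.range ν)) :=
    isCompact_closure_of_isTightMeasureSet (by convert! htight; ext; simp)
  obtain ⟨ν₀, -, φ, hφ, hlim₀⟩ := hcomp.tendsto_subseq (x := ν)
    fun n => subset_closure (Set.mem_range_self n)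
  refine ⟨ν₀, inferInstance, fun x => ?_⟩
  exact tendsto_nhds_unique (ProbabilityMeasure.tendsto_iff_tendsto_charFun.mp hlim₀ x)
    ((hchar x).comp hφ.tendsto_atTop)

end Bochner

/-! ### Compactness and Gaussian-weighted quadratic forms. -/

theorem IsCompact.exists_pos_le_of_pos_at_zero {E Y : Type*} [NormedAddCommGroup E]
    [ProperSpace E] [TopologicalSpace Y] {S : Set Y} (hS : IsCompact S) {F : E × Y → ℝ}
    (hF : Continuous F) (hpos : ∀ e ∈ S, 0 < F (0, e)) :
    ∃ c ε : ℝ, 0 < c ∧ 0 < ε ∧ ∀ a, ‖a‖ ^ 2 ≤ ε → ∀ e ∈ S, c ≤ F (a, e) := by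
  obtain ⟨u, v, hu, -, h0u, hSv, huv⟩ := generalized_tube_lemma (isCompact_singleton (x := (0 : E)))
    hS (isOpen_lt continuous_const hF) (n := {p | 0 < F p})
    (by rintro ⟨a, e⟩ ⟨ha, he⟩; obtain rfl : a = 0 := ha; exact hpos e he)
  obtain ⟨r, hr, hru⟩ := Metric.isOpen_iff.mp hu 0 (h0u rfl)
  -- Halving the radius gives a compact ball inside the open tube, so a positive lower bound exists.
  obtain ⟨c, hc, hle⟩ := ((isCompact_closedBall (0 : E) (r / 2)).prod hS).exists_forall_le'
    hF.continuousOn (a := 0) (by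
      rintro ⟨a, e⟩ ⟨ha, he⟩
      exact huv ⟨hru (Metric.closedBall_subset_ball (by linarith) ha), hSv he⟩)
  refine ⟨c, (r / 2) ^ 2, hc, by positivity, fun a ha e he => hle (a, e) ⟨?_, he⟩⟩
  rw [mem_closedBall_zero_iff]
  exact (sq_le_sq₀ (norm_nonneg _) (by positivity)).mp ha

section GaussianForm

variable {E : Type*} [NormedAddCommGroup E] [InnerProductSpace ℝ E] {σ : ℝ} {g : ℝ → ℝ}

/-- From `t exp(-t) ≤ 1` at `t = σ²‖w‖²`. The bound is free of `w`, so a finite `Λ` needs no moments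
for domination. -/
theorem norm_exp_mul_inner_sq_mul_le (hσ : 0 < σ) (hg : ∀ s, |g s| ≤ 1) {R : ℝ} (a w : E) {e : E}
    (he : ‖e‖ ≤ R) :
    ‖Real.exp (-σ ^ 2 * ‖w‖ ^ 2) * ⟪e, w⟫ ^ 2 * g ⟪a, w⟫‖ ≤ R ^ 2 / σ ^ 2 := by
  have h1 : |⟪e, w⟫| ≤ R * ‖w‖ :=
    (abs_real_inner_le_norm e w).trans (mul_le_mul_of_nonneg_right he (norm_nonneg _))
  have h2 : ⟪e, w⟫ ^ 2 ≤ R ^ 2 * ‖w‖ ^ 2 := by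
    rw [← mul_pow, ← sq_abs]
    gcongr
  have h3 : Real.exp (-σ ^ 2 * ‖w‖ ^ 2) * (σ ^ 2 * ‖w‖ ^ 2) ≤ 1 := by
    rw [neg_mul, Real.exp_neg, inv_mul_le_one₀ (Real.exp_pos _)]
    linarith [Real.add_one_le_exp (σ ^ 2 * ‖w‖ ^ 2)]
  rw [norm_mul, norm_mul, Real.norm_eq_abs, Real.norm_eq_abs, Real.norm_eq_abs, Real.abs_exp,
    abs_of_nonneg (sq_nonneg _), le_div_iff₀ (by positivity)]
  calc Real.exp (-σ ^ 2 * ‖w‖ ^ 2) * ⟪e, w⟫ ^ 2 * |g ⟪a, w⟫| * σ ^ 2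
      ≤ Real.exp (-σ ^ 2 * ‖w‖ ^ 2) * (R ^ 2 * ‖w‖ ^ 2) * 1 * σ ^ 2 := by
        gcongr
        exact hg _
    _ = R ^ 2 * (Real.exp (-σ ^ 2 * ‖w‖ ^ 2) * (σ ^ 2 * ‖w‖ ^ 2)) := by ring
    _ ≤ R ^ 2 := mul_le_of_le_one_right (sq_nonneg _) h3

variable [MeasurableSpace E] [BorelSpace E] [SecondCountableTopology E] {Λ : Measure E}
  [IsFiniteMeasure Λ]

theorem integrable_exp_mul_inner_sq_mul (hσ : 0 < σ) (hgc : Continuous g) (hg : ∀ s, |g s| ≤ 1)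
    (a e : E) :
    Integrable (fun w => Real.exp (-σ ^ 2 * ‖w‖ ^ 2) * ⟪e, w⟫ ^ 2 * g ⟪a, w⟫) Λ :=
  (integrable_const (‖e‖ ^ 2 / σ ^ 2)).mono' (by fun_prop)
    (ae_of_all _ fun w => norm_exp_mul_inner_sq_mul_le hσ hg a w le_rfl)

variable (Λ) in
theorem continuous_integral_exp_mul_inner_sq_mul (hσ : 0 < σ) (hgc : Continuous g)
    (hg : ∀ s, |g s| ≤ 1) :
    Continuous fun p : E × E =>
      ∫ w, Real.exp (-σ ^ 2 * ‖w‖ ^ 2) * ⟪p.2, w⟫ ^ 2 * g ⟪p.1, w⟫ ∂Λ := by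
  rw [continuous_iff_continuousAt]
  rintro ⟨a₀, e₀⟩
  refine continuousAt_of_dominated (bound := fun _ => (‖e₀‖ + 1) ^ 2 / σ ^ 2)
    (Eventually.of_forall fun p => by fun_prop) ?_ (integrable_const _)
    (ae_of_all _ fun w => by fun_prop)
  have : ∀ᶠ p : E × E in 𝓝 (a₀, e₀), ‖p.2‖ < ‖e₀‖ + 1 :=
    (continuous_snd.norm.tendsto (a₀, e₀)).eventually_lt_const (lt_add_one _)
  filter_upwards [this] with p hp
  exact ae_of_all _ fun w => norm_exp_mul_inner_sq_mul_le hσ hg _ w hp.le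

theorem integral_exp_mul_inner_sq_pos (hσ : 0 < σ) {e : E} (he : ¬ ∀ᵐ w ∂Λ, ⟪e, w⟫ = 0) :
    0 < ∫ w, Real.exp (-σ ^ 2 * ‖w‖ ^ 2) * ⟪e, w⟫ ^ 2 ∂Λ := by
  have hnn : ∀ w, 0 ≤ Real.exp (-σ ^ 2 * ‖w‖ ^ 2) * ⟪e, w⟫ ^ 2 := fun w => by positivity
  have hi : Integrable (fun w => Real.exp (-σ ^ 2 * ‖w‖ ^ 2) * ⟪e, w⟫ ^ 2) Λ := by
    simpa using integrable_exp_mul_inner_sq_mul (Λ := Λ) (g := fun _ => 1) hσ continuous_const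
      (by simp) 0 e
  refine (integral_nonneg hnn).lt_of_ne' fun h => he ?_
  rw [integral_eq_zero_iff_of_nonneg hnn hi] at h
  filter_upwards [h] with w hw
  simpa using hw

end GaussianForm

theorem one_sub_cos_eq_sq_mul_sinc_sq (s : ℝ) :
    1 - Real.cos s = s ^ 2 / 2 * Real.sinc (s / 2) ^ 2 := by
  have h : Real.cos s = 1 - 2 * Real.sin (s / 2) ^ 2 := by
    rw [← Real.cos_sq_add_sin_sq (s / 2)]
    nth_rw 1 [show s = 2 * (s / 2) by ring]
    rw [Real.cos_two_mul]
    linarith [Real.cos_sq_add_sin_sq (s / 2)]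
  rcases eq_or_ne s 0 with rfl | hs
  · simp
  · rw [Real.sinc_of_ne_zero (by positivity), h]
    field_simp
    ring

/-! ### The spectral measure and embeddings of Gaussians. -/

section BochnerMeasure

variable {d : ℕ} {ψ : EuclideanSpace ℝ (Fin d) → ℝ} {Λ : Measure (EuclideanSpace ℝ (Fin d))}

theorem isBochnerMeasure_iff_charFun (heven : ∀ x, ψ (-x) = ψ x) :
    IsBochnerMeasure ψ Λ ↔ IsFiniteMeasure Λ ∧
      ∀ x, charFun Λ x = (((2 * Real.pi) ^ ((d : ℝ) / 2) * ψ x : ℝ) : ℂ) := by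
  refine and_congr_right fun _ => (Equiv.neg _).forall_congr fun {x} => ?_
  have h : ∫ w, Complex.exp (-Complex.I * (⟪x, w⟫ : ℝ)) ∂Λ = charFun Λ (-x) := by
    rw [charFun_apply]
    congr with w
    rw [inner_neg_right, real_inner_comm]
    push_cast
    ring_nf
  have hp : (((2 * Real.pi) ^ ((d : ℝ) / 2) : ℝ) : ℂ) ≠ 0 := by
    exact_mod_cast (by positivity : (2 * Real.pi) ^ ((d : ℝ) / 2) ≠ 0)
  rw [h, Equiv.neg_apply, heven, one_div, Complex.ofReal_inv, Complex.ofReal_mul,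
    eq_inv_mul_iff_mul_eq₀ hp, eq_comm]

theorem IsBochnerMeasure.unique {Λ' : Measure (EuclideanSpace ℝ (Fin d))}
    (heven : ∀ x, ψ (-x) = ψ x) (h : IsBochnerMeasure ψ Λ) (h' : IsBochnerMeasure ψ Λ') :
    Λ = Λ' := by
  rw [isBochnerMeasure_iff_charFun heven] at h h'
  have := h.1
  have := h'.1
  exact Measure.ext_of_charFun (funext fun x => (h.2 x).trans (h'.2 x).symm)

theorem IsTranslationFeature.exists_isBochnerMeasure {H : Type*} [NormedAddCommGroup H]
    [InnerProductSpace ℝ H] [CompleteSpace H] {k : EuclideanSpace ℝ (Fin d) → H}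
    (hk : IsTranslationFeature ψ k) (hψ : Continuous ψ) (h0 : 0 < ψ 0) :
    ∃ Λ, IsBochnerMeasure ψ Λ := by
  obtain ⟨ν, hν, h⟩ := hk.exists_charFun_eq_div hψ h0
  have hc : 0 ≤ (2 * Real.pi) ^ ((d : ℝ) / 2) * ψ 0 := by positivity
  refine ⟨ENNReal.ofReal ((2 * Real.pi) ^ ((d : ℝ) / 2) * ψ 0) • ν,
    (isBochnerMeasure_iff_charFun hk.even).mpr ⟨ν.smul_finite ENNReal.ofReal_ne_top, fun x => ?_⟩⟩
  rw [charFun_apply, integral_smul_measure, ← charFun_apply, h, ENNReal.toReal_ofReal hc,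
    Complex.real_smul, ← Complex.ofReal_mul]
  congr 1
  field_simp

/-- Used in contrapositive form: a characteristic kernel has no spectral measure carried by a
hyperplane. -/
theorem IsBochnerMeasure.apply_eq_of_ae_inner_eq_zero (h : IsBochnerMeasure ψ Λ)
    {e : EuclideanSpace ℝ (Fin d)} (he : ∀ᵐ w ∂Λ, ⟪e, w⟫ = 0) : ψ e = ψ 0 := by
  have h1 : ∫ w, Complex.exp (-Complex.I * (⟪e, w⟫ : ℝ)) ∂Λ =
      ∫ w, Complex.exp (-Complex.I * (⟪(0 : EuclideanSpace ℝ (Fin d)), w⟫ : ℝ)) ∂Λ := by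
    refine integral_congr_ae ?_
    filter_upwards [he] with w hw
    rw [hw, inner_zero_left]
  have := (h.2 e).trans ((congrArg _ h1).trans (h.2 0).symm)
  exact_mod_cast this

/-- The mean embedding inner product, on the spectral side. -/
theorem IsBochnerMeasure.integral_integral_eq (heven : ∀ x, ψ (-x) = ψ x) (hψ : Continuous ψ)
    {M : ℝ} (hM : ∀ x, |ψ x| ≤ M) (h : IsBochnerMeasure ψ Λ)
    (P Q : Measure (EuclideanSpace ℝ (Fin d))) [IsFiniteMeasure P] [IsFiniteMeasure Q] :
    ((∫ x, ∫ y, ψ (x - y) ∂Q ∂P : ℝ) : ℂ) = (1 / (2 * Real.pi) ^ ((d : ℝ) / 2) : ℝ) *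
      ∫ w, charFun P w * charFun Q (-w) ∂Λ := by
  have := h.1
  have hi : Integrable (fun z : EuclideanSpace ℝ (Fin d) × EuclideanSpace ℝ (Fin d) =>
      ψ (z.1 - z.2)) (P.prod Q) :=
    (integrable_const M).mono' (by fun_prop) (ae_of_all _ fun z => hM _)
  rw [integral_integral hi, ← integral_complex_ofReal]
  have h1 : ∀ z : EuclideanSpace ℝ (Fin d) × EuclideanSpace ℝ (Fin d), (ψ (z.1 - z.2) : ℂ) =
      (1 / (2 * Real.pi) ^ ((d : ℝ) / 2) : ℝ) *
        ∫ w, Complex.exp (⟪z.1, w⟫ * Complex.I) * Complex.exp (⟪z.2, -w⟫ * Complex.I) ∂Λ :=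
    fun z => by
      rw [← heven, h.2]
      congr 2 with w
      rw [← Complex.exp_add, inner_neg_left, inner_sub_left, inner_neg_right]
      push_cast
      ring_nf
  simp_rw [h1]
  rw [integral_const_mul, integral_integral_swap]
  · congr 2 with w
    rw [integral_prod_mul (fun x => Complex.exp (⟪x, w⟫ * Complex.I))
      (fun y => Complex.exp (⟪y, -w⟫ * Complex.I)), charFun_apply, charFun_apply]
  · refine (integrable_const (1 : ℝ)).mono' (by fun_prop) (ae_of_all _ fun z => ?_)
    simp [Function.uncurry, Complex.norm_exp]

theorem charFun_isotropicGaussian (μ : EuclideanSpace ℝ (Fin d)) (σ : ℝ)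
    (w : EuclideanSpace ℝ (Fin d)) :
    charFun (isotropicGaussian μ σ) w =
      Complex.exp (⟪w, μ⟫ * Complex.I - ((σ ^ 2 * ‖w‖ ^ 2 : ℝ) : ℂ) / 2) := by
  have hS : (σ ^ 2 • (1 : Matrix (Fin d) (Fin d) ℝ)).PosSemidef :=
    Matrix.PosSemidef.one.smul (sq_nonneg σ)
  rw [isotropicGaussian, charFun_multivariateGaussian hS, Matrix.smul_mulVec, Matrix.one_mulVec,
    dotProduct_smul, EuclideanSpace.real_norm_sq_eq]
  simp [dotProduct, sq]

instance (μ : EuclideanSpace ℝ (Fin d)) (σ : ℝ) : IsProbabilityMeasure (isotropicGaussian μ σ) := by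
  rw [isotropicGaussian]
  infer_instance

section Gaussian

variable [Fact (IsPositiveDefinite ψ)]

/-- Each characteristic function contributes `exp(-σ²‖w‖²/2)`, and the phases combine to that of `μ₀
- μ₁`; only the real part survives. -/
theorem IsBochnerMeasure.inner_kernelMean_isotropicGaussian (hψ : Continuous ψ)
    (h : IsBochnerMeasure ψ Λ) (μ₀ μ₁ : EuclideanSpace ℝ (Fin d)) (σ : ℝ) :
    ⟪kernelMean ψ (isotropicGaussian μ₀ σ), kernelMean ψ (isotropicGaussian μ₁ σ)⟫ =
      1 / (2 * Real.pi) ^ ((d : ℝ) / 2) *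
        ∫ w, Real.exp (-σ ^ 2 * ‖w‖ ^ 2) * Real.cos ⟪μ₀ - μ₁, w⟫ ∂Λ := by
  have := h.1
  have hk := isTranslationFeature_kerFun ψ
  have h1 := h.integral_integral_eq hk.even hψ hk.abs_le (isotropicGaussian μ₀ σ)
    (isotropicGaussian μ₁ σ)
  have h2 : ∀ w, charFun (isotropicGaussian μ₀ σ) w * charFun (isotropicGaussian μ₁ σ) (-w) =
      Real.exp (-σ ^ 2 * ‖w‖ ^ 2) * Complex.exp (⟪μ₀ - μ₁, w⟫ * Complex.I) := fun w => by
    rw [charFun_isotropicGaussian, charFun_isotropicGaussian, norm_neg, ← Complex.exp_add,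
      Complex.ofReal_exp, ← Complex.exp_add, inner_sub_left, inner_neg_left, real_inner_comm w,
      real_inner_comm w]
    push_cast
    ring_nf
  simp_rw [h2] at h1
  have hi : Integrable (fun w => (Real.exp (-σ ^ 2 * ‖w‖ ^ 2) : ℂ) *
      Complex.exp (⟪μ₀ - μ₁, w⟫ * Complex.I)) Λ := by
    refine (integrable_const (1 : ℝ)).mono' (by fun_prop) (ae_of_all _ fun w => ?_)
    rw [norm_mul, Complex.norm_exp_ofReal_mul_I, mul_one, Complex.norm_real, Real.norm_eq_abs,
      Real.abs_exp, Real.exp_le_one_iff, neg_mul, neg_nonpos]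
    positivity
  rw [kernelMean, kernelMean, hk.inner_integral hψ]
  have h3 := congrArg Complex.re h1
  rw [Complex.ofReal_re, Complex.re_ofReal_mul] at h3
  rw [h3]
  congr 1
  refine (integral_re hi).symm.trans ?_
  congr with w
  change Complex.re _ = _
  rw [Complex.re_ofReal_mul, Complex.exp_ofReal_mul_I_re]

theorem IsBochnerMeasure.norm_kernelMean_isotropicGaussian_sub_sq (hψ : Continuous ψ)
    (h : IsBochnerMeasure ψ Λ) (μ₀ μ₁ : EuclideanSpace ℝ (Fin d)) (σ : ℝ) :
    ‖kernelMean ψ (isotropicGaussian μ₀ σ) - kernelMean ψ (isotropicGaussian μ₁ σ)‖ ^ 2 =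
      1 / (2 * Real.pi) ^ ((d : ℝ) / 2) *
        ∫ w, Real.exp (-σ ^ 2 * ‖w‖ ^ 2) * ⟪μ₀ - μ₁, w⟫ ^ 2 *
          Real.sinc (⟪μ₀ - μ₁, w⟫ / 2) ^ 2 ∂Λ := by
  have := h.1
  have hi : ∀ a : EuclideanSpace ℝ (Fin d),
      Integrable (fun w => Real.exp (-σ ^ 2 * ‖w‖ ^ 2) * Real.cos ⟪a, w⟫) Λ := fun a => by
    refine (integrable_const (1 : ℝ)).mono' (by fun_prop) (ae_of_all _ fun w => ?_)
    rw [norm_mul, Real.norm_eq_abs, Real.abs_exp]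
    refine mul_le_one₀ ?_ (norm_nonneg _) (Real.abs_cos_le_one _)
    rw [Real.exp_le_one_iff, neg_mul, neg_nonpos]
    positivity
  rw [norm_sub_sq_real, ← real_inner_self_eq_norm_sq, ← real_inner_self_eq_norm_sq,
    h.inner_kernelMean_isotropicGaussian hψ, h.inner_kernelMean_isotropicGaussian hψ,
    h.inner_kernelMean_isotropicGaussian hψ, sub_self, sub_self]
  have h1 : ∀ w, Real.exp (-σ ^ 2 * ‖w‖ ^ 2) * ⟪μ₀ - μ₁, w⟫ ^ 2 *
      Real.sinc (⟪μ₀ - μ₁, w⟫ / 2) ^ 2 =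
      2 * (Real.exp (-σ ^ 2 * ‖w‖ ^ 2) * Real.cos ⟪(0 : EuclideanSpace ℝ (Fin d)), w⟫ -
        Real.exp (-σ ^ 2 * ‖w‖ ^ 2) * Real.cos ⟪μ₀ - μ₁, w⟫) := fun w => by
    rw [inner_zero_left, Real.cos_zero]
    linear_combination (-2 * Real.exp (-σ ^ 2 * ‖w‖ ^ 2)) *
      one_sub_cos_eq_sq_mul_sinc_sq ⟪μ₀ - μ₁, w⟫
  simp_rw [h1]
  rw [integral_const_mul, integral_sub (hi _) (hi _)]
  ring

end Gaussian

theorem continuous_spectralForm [IsFiniteMeasure Λ] {σ : ℝ} (hσ : 0 < σ)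
    (a : EuclideanSpace ℝ (Fin d)) : Continuous (spectralForm Λ σ a) := by
  have h := (continuous_integral_exp_mul_inner_sq_mul Λ hσ Real.continuous_cos
    Real.abs_cos_le_one).comp (Continuous.prodMk_right a)
  unfold spectralForm spectralIntegrand
  exact continuous_const.mul h

variable [Fact (IsPositiveDefinite ψ)]

/-- Generality in `g` lets one argument serve both `cos` and `sinc²(·/2)`. -/
theorem IsBochnerMeasure.exists_pos_le_integral (hψ : Continuous ψ) (hchar : IsCharacteristic ψ)
    (h : IsBochnerMeasure ψ Λ) {σ : ℝ} (hσ : 0 < σ) {g : ℝ → ℝ} (hgc : Continuous g)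
    (hg : ∀ s, |g s| ≤ 1) (hg0 : g 0 = 1) :
    ∃ c ε : ℝ, 0 < c ∧ 0 < ε ∧ ∀ a : EuclideanSpace ℝ (Fin d), ‖a‖ ^ 2 ≤ ε →
      ∀ e ∈ Metric.sphere (0 : EuclideanSpace ℝ (Fin d)) 1,
        c ≤ ∫ w, Real.exp (-σ ^ 2 * ‖w‖ ^ 2) * ⟪e, w⟫ ^ 2 * g ⟪a, w⟫ ∂Λ := by
  have := h.1
  refine (isCompact_sphere (0 : EuclideanSpace ℝ (Fin d)) 1).exists_pos_le_of_pos_at_zero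
    (continuous_integral_exp_mul_inner_sq_mul Λ hσ hgc hg) fun e he => ?_
  simp only [inner_zero_left, hg0, mul_one]
  exact integral_exp_mul_inner_sq_pos hσ fun h0 =>
    (hchar.apply_lt_apply_zero hψ (ne_zero_of_mem_unit_sphere ⟨e, he⟩)).ne
      (h.apply_eq_of_ae_inner_eq_zero h0)

theorem IsBochnerMeasure.le_norm_kernelMean_isotropicGaussian_sub_sq (hψ : Continuous ψ)
    (h : IsBochnerMeasure ψ Λ) {μ₀ μ₁ : EuclideanSpace ℝ (Fin d)} {σ c : ℝ}
    (hc : ∀ e ∈ Metric.sphere (0 : EuclideanSpace ℝ (Fin d)) 1,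
      c ≤ ∫ w, Real.exp (-σ ^ 2 * ‖w‖ ^ 2) * ⟪e, w⟫ ^ 2 *
        Real.sinc (⟪μ₀ - μ₁, w⟫ / 2) ^ 2 ∂Λ) :
    1 / (2 * Real.pi) ^ ((d : ℝ) / 2) * (‖μ₀ - μ₁‖ ^ 2 * c) ≤
      ‖kernelMean ψ (isotropicGaussian μ₀ σ) - kernelMean ψ (isotropicGaussian μ₁ σ)‖ ^ 2 := by
  rw [h.norm_kernelMean_isotropicGaussian_sub_sq hψ]
  rcases eq_or_ne (μ₀ - μ₁) 0 with h0 | h0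
  · simp [h0]
  set a := μ₀ - μ₁
  have ha := norm_ne_zero_iff.mpr h0
  have he : ‖a‖⁻¹ • a ∈ Metric.sphere (0 : EuclideanSpace ℝ (Fin d)) 1 := by
    rw [mem_sphere_zero_iff_norm, norm_smul, norm_inv, norm_norm, inv_mul_cancel₀ ha]
  -- Only the quadratic factor is rescaled to a unit vector; the `sinc` factor keeps `a`, whose size
  -- the hypothesis controls.
  have heq : ∫ w, Real.exp (-σ ^ 2 * ‖w‖ ^ 2) * ⟪a, w⟫ ^ 2 * Real.sinc (⟪a, w⟫ / 2) ^ 2 ∂Λ =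
      ‖a‖ ^ 2 * ∫ w, Real.exp (-σ ^ 2 * ‖w‖ ^ 2) * ⟪‖a‖⁻¹ • a, w⟫ ^ 2 *
        Real.sinc (⟪a, w⟫ / 2) ^ 2 ∂Λ := by
    rw [← integral_const_mul]
    congr with w
    rw [real_inner_smul_left]
    field_simp
  rw [heq]
  gcongr
  exact hc _ he

end BochnerMeasure

theorem proposition3 {d : ℕ} (hd : 0 < d) (ψ : EuclideanSpace ℝ (Fin d) →ᵇ ℝ)
    [Fact (IsPositiveDefinite ψ)] (hchar : IsCharacteristic ψ) (σ : ℝ) (hσ : 0 < σ) :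
    (∃! Λ : Measure (EuclideanSpace ℝ (Fin d)), IsBochnerMeasure ψ Λ) ∧
    ∃ c ε : ℝ, 0 < c ∧ 0 < ε ∧
      (∀ Λ : Measure (EuclideanSpace ℝ (Fin d)), IsBochnerMeasure ψ Λ →
        ∀ a : EuclideanSpace ℝ (Fin d), ‖a‖ ^ 2 ≤ ε →
          (∀ e ∈ Metric.sphere (0 : EuclideanSpace ℝ (Fin d)) 1,
            Integrable (spectralIntegrand σ a e) Λ) ∧
          ∃ m : ℝ, IsLeast (spectralForm Λ σ a '' Metric.sphere 0 1) m ∧ c ≤ m) ∧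
      ∀ μ₀ μ₁ : EuclideanSpace ℝ (Fin d), ‖μ₀ - μ₁‖ ^ 2 ≤ ε →
        Real.sqrt (c / 2) * ‖μ₀ - μ₁‖ ≤
          ‖kernelMean ψ (isotropicGaussian μ₀ σ) - kernelMean ψ (isotropicGaussian μ₁ σ)‖ := by
  have hψ : Continuous ψ := ψ.continuous
  have hk := isTranslationFeature_kerFun ψ
  obtain ⟨Λ, hΛ⟩ := hk.exists_isBochnerMeasure hψ (hchar.apply_zero_pos hψ hd)
  have huniq : ∀ Λ', IsBochnerMeasure ψ Λ' → Λ' = Λ := fun Λ' h' => h'.unique hk.even hΛ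
  refine ⟨⟨Λ, hΛ, huniq⟩, ?_⟩
  have := hΛ.1
  have hsne : (Metric.sphere (0 : EuclideanSpace ℝ (Fin d)) 1).Nonempty :=
    ⟨EuclideanSpace.single ⟨0, hd⟩ 1, by simp⟩
  obtain ⟨c₁, ε₁, hc₁, hε₁, h₁⟩ := hΛ.exists_pos_le_integral hψ hchar hσ Real.continuous_cos
    Real.abs_cos_le_one Real.cos_zero
  obtain ⟨c₂, ε₂, hc₂, hε₂, h₂⟩ := hΛ.exists_pos_le_integral hψ hchar hσ
    (g := fun s => Real.sinc (s / 2) ^ 2) (by fun_prop)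
    (fun s => by
      rw [abs_pow]
      exact pow_le_one₀ (abs_nonneg _) (Real.abs_sinc_le_one _))
    (by simp)
  -- The prefactor is that of `spectralForm`; halving it under the square root gives the prefactor
  -- of the squared distance.
  refine ⟨2 / (2 * Real.pi) ^ ((d : ℝ) / 2) * min c₁ c₂, min ε₁ ε₂, by positivity, by positivity,
    fun Λ' h' a ha => ?_, fun μ₀ μ₁ hμ => ?_⟩
  · rw [huniq Λ' h']
    refine ⟨fun e _ => integrable_exp_mul_inner_sq_mul hσ Real.continuous_cos
      Real.abs_cos_le_one a e, ?_⟩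
    obtain ⟨m, hm⟩ := ((isCompact_sphere _ _).image
      (continuous_spectralForm (Λ := Λ) hσ a)).exists_isLeast (hsne.image _)
    refine ⟨m, hm, ?_⟩
    obtain ⟨e, he, rfl⟩ := hm.1
    exact mul_le_mul_of_nonneg_left ((min_le_left _ _).trans
      (h₁ a (ha.trans (min_le_left _ _)) e he)) (by positivity)
  · refine le_of_sq_le_sq ?_ (norm_nonneg _)
    rw [mul_pow, Real.sq_sqrt (by positivity)]
    refine le_of_eq_of_le ?_ (hΛ.le_norm_kernelMean_isotropicGaussian_sub_sq hψ fun e he =>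
      (min_le_right c₁ c₂).trans (h₂ _ (hμ.trans (min_le_right _ _)) e he))
    ring
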